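/- Let $d\ge 2$ and $\rho\ge 1$. There is a constant $c>0$, depending only on $d$ and $\rho$, such that the following holds for every axis-parallel box $B=\prod_{k=1}^d[a_k,b_k]\subset\mathbb{R}^d$ with $a_k<b_k$, whose side lengths satisfy $b_k-a_k\le\rho\,(b_l-a_l)$ for all $k,l$ (for a cube $\rho=1$, so that $c$ depends only on $d$), and for every $n\ge 3$. Let $p_1,\dots,p_n$ be independent uniform random points of $B$. Build a tree incrementally: $T'_1$ is the single vertex $p_1$, and for $k\ge 2$ the tree $T'_k$ arises from $T'_{k-1}$ by adding the vertex $p_k$ and the straight edge $p_kq_k$, where $q_k$ is a point nearest to $p_k$ (in the Euclidean distance) in the swath of $T'_{k-1}$, that is, in the set of all its vertices and all points on its edges. Ties are broken by an arbitrary rule that depends only on $p_k$ and $T'_{k-1}$. Let $i$ be uniform in $\{1,\dots,n\}$ and independent of the points. Then, with probability at least $c$, the following event occurs: $i\ge 2$; there is a unique point $p_j$ nearest to $p_i$ among $p_1,\dots,p_{i-1}$; $j\ge 2$ (so that $p_j$ has an edge $p_jq_j$ which attached it to $T'_{j-1}$); and $|p_jq_j|>|p_ip_j|$. -/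

import Mathlib

open MeasureTheory ProbabilityTheory

noncomputable section

/-- Points of `ℝ^d`, with the Euclidean norm. -/
abbrev Pt (d : ℕ) : Type := EuclideanSpace ℝ (Fin d)

/-- A (finite, straight-line) geometric graph `(V, E)` in `ℝ^d`. An edge is the segment between
the two points of a pair; its endpoints need not be vertices, since an edge may be attached to an
interior point of another edge. -/
structure GeomGraph (d : ℕ) where
  verts : Finset (Pt d)
  edges : Finset (Pt d × Pt d)

/-- The swath of a geometric graph: all its vertices and all the points on its edges. -/
def GeomGraph.swath {d : ℕ} (T : GeomGraph d) : Set (Pt d) :=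
  (T.verts : Set (Pt d)) ∪ ⋃ e ∈ T.edges, segment ℝ e.1 e.2

/-- The length of an edge. -/
def edgeLength {d : ℕ} (e : Pt d × Pt d) : ℝ := dist e.1 e.2

/-- The rule `connect` is a tree-nearest-neighbour rule: the edge that it returns for a point `p`
and a nonempty geometric graph `T` joins `p` to a point of the swath of `T` that is nearest to `p`
(ties may be broken in any way). -/
def IsTreeNN {d : ℕ} (connect : Pt d → GeomGraph d → Pt d × Pt d) : Prop :=
  ∀ (p : Pt d) (T : GeomGraph d), T.verts.Nonempty →
    (connect p T).1 = p ∧ (connect p T).2 ∈ T.swath ∧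
      ∀ q ∈ T.swath, dist p (connect p T).2 ≤ dist p q

open Classical in
/-- One iteration: add the vertex `p`, and the edge that connects it to the current graph `T`
(there is no such edge for the first point, when `T` is empty). -/
def addPoint {d : ℕ} (connect : Pt d → GeomGraph d → Pt d × Pt d) (T : GeomGraph d) (p : Pt d) :
    GeomGraph d where
  verts := insert p T.verts
  edges := if T.verts.Nonempty then insert (connect p T) T.edges else T.edges

/-- The tree after the first `k` iterations on the input sequence `p 0, …, p (n - 1)`. -/
def buildTree {d n : ℕ} (connect : Pt d → GeomGraph d → Pt d × Pt d) (p : Fin n → Pt d) :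
    ℕ → GeomGraph d
  | 0 => ⟨∅, ∅⟩
  | k + 1 =>
    if h : k < n then addPoint connect (buildTree connect p k) (p ⟨k, h⟩)
    else buildTree connect p k

/-- The point `p j` is the nearest neighbour of `p i` among the earlier points
`p 0, …, p (i - 1)`: it is strictly closer to `p i` than all the other ones. -/
def IsNearestEarlier {d n : ℕ} (p : Fin n → Pt d) (i j : Fin n) : Prop :=
  j < i ∧ ∀ k, k < i → k ≠ j → dist (p i) (p j) < dist (p i) (p k)

/-- The nearest earlier neighbour `p j` of `p i` exists, it is not the first point (so that there
is an edge that attached it to the tree of its predecessors), and this edge is longer than the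
distance between `p i` and `p j`. -/
def OldEdgeIsLonger {d n : ℕ} (connect : Pt d → GeomGraph d → Pt d × Pt d) (p : Fin n → Pt d)
    (i : Fin n) : Prop :=
  ∃ j : Fin n, IsNearestEarlier p i j ∧ 0 < (j : ℕ) ∧
    dist (p i) (p j) < edgeLength (connect (p j) (buildTree connect p j))

/-- The axis-parallel box `∏ k, [a k, b k]`. -/
def box {d : ℕ} (a b : Fin d → ℝ) : Set (Pt d) :=
  {x | ∀ k, x k ∈ Set.Icc (a k) (b k)}

/-- The joint law of `n` independent uniform points of the box and of an index `i` which is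
uniform in `Fin n` and independent of the points. -/
def sampleLaw {d : ℕ} (n : ℕ) (a b : Fin d → ℝ) : Measure ((Fin n → Pt d) × Fin n) :=
  (Measure.pi fun _ : Fin n => cond (volume : Measure (Pt d)) (box a b)).prod
    (uniformOn (Set.univ : Set (Fin n)))

end

/-! Fix `j < i` and a length `s` that is a small multiple of `L * i ^ (-1/d)`, with `L` the shortest
side of the box. Suppose that `p j` is at distance at least `s` from the tree of its predecessors,
that no point between `j` and `i` falls within `s` of `p j`, and that `p i` falls within `s / 2` of
`p j`. Then `p j` is the nearest earlier neighbour of `p i`, and its edge has length at least `s`.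
The three stages have conditional probabilities at least `1/2`, `1/2` and `c₀ / i` (`exists_scale`,
`half_le_prod`), so the pair contributes at least `c₀ / (4 i)` (`le_measure_nearest_and_longer`).
For distinct `j` the events are disjoint; summing over `j` and averaging over `i` leaves a constant.

The first stage carries the geometry: the `s`-neighbourhood of every tree on at most `k` points must
fill at most half of the box. Each edge is no longer than the distance to any predecessor, so points
with edges longer than `r` are pairwise `r`-separated, and packing bounds their number. Dyadic
summation gives total length `O(k * δ)` with `δ = L * k ^ (-1/d)` (`sum_length_le`). A neighbourhood
of radius `ε * δ` then has volume `O(ε ^ (d - 1) + ε ^ d) * L ^ d`, which is small for `d ≥ 2`. -/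

/-! ### Packing of separated points. -/

/-- The volume of the Euclidean unit ball. -/
noncomputable def unitBallVolume (d : ℕ) : ℝ := volume.real (Metric.ball (0 : Pt d) 1)

theorem unitBallVolume_pos (d : ℕ) : 0 < unitBallVolume d :=
  ENNReal.toReal_pos (Metric.measure_ball_pos _ _ one_pos).ne' measure_ball_lt_top.ne

theorem volume_real_ball {d : ℕ} (x : Pt d) {r : ℝ} (hr : 0 < r) :
    volume.real (Metric.ball x r) = r ^ d * unitBallVolume d := by
  rw [measureReal_def, Measure.addHaar_ball_of_pos _ x hr, ENNReal.toReal_mul,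
    ENNReal.toReal_ofReal (by positivity), finrank_euclideanSpace_fin]
  rfl

/-- Points that are pairwise at distance at least `r` in a ball of radius `D`: their number is at
most `(3 D / r) ^ d`. -/
theorem card_mul_pow_le_of_separated {d : ℕ} {ι : Type*} (J : Finset ι) (p : ι → Pt d) (c : Pt d)
    {r D : ℝ} (hr : 0 < r) (hrD : r ≤ D) (hD : ∀ l ∈ J, dist (p l) c ≤ D)
    (hsep : ∀ l ∈ J, ∀ m ∈ J, l ≠ m → r ≤ dist (p l) (p m)) :
    (J.card : ℝ) * r ^ d ≤ (3 * D) ^ d := by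
  have hdisj : (J : Set ι).PairwiseDisjoint fun l => Metric.ball (p l) (r / 2) := by
    intro l hl m hm hlm
    exact Metric.ball_disjoint_ball (by linarith [hsep l hl m hm hlm])
  have hunion := measureReal_biUnion_finset (μ := (volume : Measure (Pt d))) hdisj
    (fun _ _ => measurableSet_ball) (fun _ _ => measure_ball_lt_top.ne)
  -- `D + r / 2 ≤ 3 * D / 2` because `r ≤ D`.
  have hsub : (⋃ l ∈ J, Metric.ball (p l) (r / 2)) ⊆ Metric.ball c (3 * D / 2) := by
    intro z hz
    simp only [Set.mem_iUnion, Metric.mem_ball] at hz ⊢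
    obtain ⟨l, hl, hz⟩ := hz
    linarith [dist_triangle z (p l) c, hD l hl]
  have hle := measureReal_mono (μ := (volume : Measure (Pt d))) hsub measure_ball_lt_top.ne
  rw [hunion, volume_real_ball c (by linarith)] at hle
  simp only [volume_real_ball _ (half_pos hr), Finset.sum_const, nsmul_eq_mul] at hle
  rw [← mul_assoc] at hle
  have h := le_of_mul_le_mul_right hle (unitBallVolume_pos d)
  rw [div_pow, div_pow, mul_div_assoc', div_le_div_iff_of_pos_right (by positivity)] at h
  exact h

/-! ### Total edge length and the volume around a segment. -/

/-- A dyadic bound of a real number by its layers. -/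
theorem le_add_sum_layers {δ x : ℝ} (hδ : 0 < δ) (N : ℕ) (hx : x ≤ δ * 2 ^ N) :
    x ≤ δ + ∑ u ∈ Finset.range N, δ * 2 ^ (u + 1) * (if δ * 2 ^ u < x then 1 else 0) := by
  induction N with
  | zero => simpa using hx
  | succ N ih =>
    rw [Finset.sum_range_succ]
    by_cases h : δ * 2 ^ N < x
    · have : 0 ≤ ∑ u ∈ Finset.range N, δ * 2 ^ (u + 1) * (if δ * 2 ^ u < x then (1 : ℝ) else 0) :=
        Finset.sum_nonneg fun u _ => by split_ifs <;> positivity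
      simp only [h, if_true]
      linarith
    · have := ih (not_lt.1 h)
      simpa [h] using this

/-- The sum of the lengths of edges that attach each point of a ball to its predecessors, each
edge being at most as long as the distance to any predecessor. -/
theorem sum_length_le {d : ℕ} (hd : 2 ≤ d) {ι : Type*} [LinearOrder ι] (J : Finset ι)
    (p : ι → Pt d) (ℓ : ι → ℝ) (c : Pt d) {D δ K C : ℝ} (hδ : 0 < δ) (hC : 0 ≤ C)
    (hD : ∀ l ∈ J, dist (p l) c ≤ D)
    (hℓD : ∀ l ∈ J, ℓ l ≤ D) (hℓ : ∀ l ∈ J, ∀ m ∈ J, m < l → ℓ l ≤ dist (p l) (p m))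
    (hJ : (J.card : ℝ) ≤ K) (hDC : (3 * D) ^ d ≤ C * (K * δ ^ d)) :
    ∑ l ∈ J, ℓ l ≤ (1 + 4 * C) * (K * δ) := by
  classical
  have hK : 0 ≤ K := le_trans (Nat.cast_nonneg _) hJ
  obtain ⟨N, hN⟩ : ∃ N : ℕ, D ≤ δ * 2 ^ N := by
    obtain ⟨N, hN⟩ := pow_unbounded_of_one_lt (D / δ) (one_lt_two)
    exact ⟨N, by rw [div_lt_iff₀ hδ] at hN; linarith⟩
  -- Of two points with long edges, the later one has the earlier one as a predecessor, so their
  -- distance exceeds `δ * 2 ^ u`. Packing gives decay `2 ^ (-u * d)`, and `d ≥ 2` makes it beat the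
  -- factor `2 ^ (u + 1)` in the layer sum.
  have hcount : ∀ u : ℕ, ((J.filter fun l => δ * 2 ^ u < ℓ l).card : ℝ) ≤ C * K * (1 / 4) ^ u := by
    intro u
    have hr : 0 < δ * 2 ^ u := by positivity
    have key : ((J.filter fun l => δ * 2 ^ u < ℓ l).card : ℝ) * (δ * 2 ^ u) ^ d ≤
        C * (K * δ ^ d) := by
      by_cases hlt : δ * 2 ^ u ≤ D
      · refine le_trans (card_mul_pow_le_of_separated _ p c hr hlt
          (fun l hl => hD l (Finset.mem_filter.1 hl).1) ?_) hDC
        intro l hl m hm hlm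
        rw [Finset.mem_filter] at hl hm
        rcases lt_or_gt_of_ne hlm with h | h
        · rw [dist_comm]; exact hm.2.le.trans (hℓ m hm.1 l hl.1 h)
        · exact hl.2.le.trans (hℓ l hl.1 m hm.1 h)
      · have : J.filter (fun l => δ * 2 ^ u < ℓ l) = ∅ := by
          refine Finset.filter_eq_empty_iff.2 fun l hl => ?_
          have := hℓD l hl
          push Not at hlt ⊢
          linarith
        rw [this]
        simp only [Finset.card_empty, Nat.cast_zero, zero_mul]
        positivity
    have h4 : (4 : ℝ) ^ u ≤ (2 ^ u) ^ d := by
      rw [show (4 : ℝ) ^ u = (2 ^ u) ^ 2 by rw [← pow_mul, mul_comm, pow_mul]; norm_num]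
      exact pow_le_pow_right₀ (one_le_pow₀ one_le_two) hd
    have h5 : ((J.filter fun l => δ * 2 ^ u < ℓ l).card : ℝ) * 4 ^ u ≤ C * K := by
      have hδd : 0 < δ ^ d := by positivity
      refine le_of_mul_le_mul_right ?_ hδd
      calc ((J.filter fun l => δ * 2 ^ u < ℓ l).card : ℝ) * 4 ^ u * δ ^ d
          ≤ ((J.filter fun l => δ * 2 ^ u < ℓ l).card : ℝ) * (2 ^ u) ^ d * δ ^ d := by gcongr
        _ = ((J.filter fun l => δ * 2 ^ u < ℓ l).card : ℝ) * (δ * 2 ^ u) ^ d := by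
          rw [mul_pow]; ring
        _ ≤ _ := by linarith
    rw [one_div, inv_pow, ← div_eq_mul_inv, le_div_iff₀ (by positivity)]
    exact h5
  have hgeom : ∑ u ∈ Finset.range N, (1 / 2 : ℝ) ^ u ≤ 2 := by
    have := sum_geometric_two_le N
    simpa using this
  calc ∑ l ∈ J, ℓ l
      ≤ ∑ l ∈ J, (δ + ∑ u ∈ Finset.range N,
          δ * 2 ^ (u + 1) * (if δ * 2 ^ u < ℓ l then 1 else 0)) :=
        Finset.sum_le_sum fun l hl => le_add_sum_layers hδ N ((hℓD l hl).trans hN)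
    _ = J.card * δ + ∑ u ∈ Finset.range N,
          δ * 2 ^ (u + 1) * ((J.filter fun l => δ * 2 ^ u < ℓ l).card : ℝ) := by
        rw [Finset.sum_add_distrib, Finset.sum_comm]
        simp only [Finset.sum_const, nsmul_eq_mul, ← Finset.mul_sum, Finset.sum_boole]
    _ ≤ K * δ + ∑ u ∈ Finset.range N, δ * 2 ^ (u + 1) * (C * K * (1 / 4) ^ u) := by
        gcongr with u
        exact hcount u
    _ = K * δ + 2 * C * K * δ * ∑ u ∈ Finset.range N, (1 / 2 : ℝ) ^ u := by
        rw [Finset.mul_sum]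
        congr 1
        refine Finset.sum_congr rfl fun u _ => ?_
        rw [show (1 / 4 : ℝ) = (1 / 2) * (1 / 2) by norm_num, mul_pow,
          show (1 / 2 : ℝ) ^ u = (2 ^ u)⁻¹ by rw [one_div, inv_pow]]
        field_simp
        ring
    _ ≤ K * δ + 2 * C * K * δ * 2 := by gcongr
    _ = _ := by ring

/-- Equally spaced points on the segment, less than `s` apart, are centres of balls of radius `2 *
s` that cover the neighbourhood; `dist x y / s + 2` of them suffice. -/
theorem volume_real_thickening_segment_le {d : ℕ} (x y : Pt d) {s : ℝ} (hs : 0 < s) :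
    volume.real (Metric.thickening s (segment ℝ x y)) ≤
      (dist x y / s + 2) * ((2 * s) ^ d * unitBallVolume d) := by
  set N : ℕ := ⌊dist x y / s⌋₊ + 1 with hN
  have hN0 : (0 : ℝ) < N := by positivity
  have hNle : (N : ℝ) ≤ dist x y / s + 1 := by
    rw [hN]; push_cast
    linarith [Nat.floor_le (show 0 ≤ dist x y / s by positivity)]
  have hNs : dist x y < s * N := by
    have := Nat.lt_floor_add_one (dist x y / s)
    rw [div_lt_iff₀ hs] at this
    rw [hN]; push_cast; linarith
  have hsub : Metric.thickening s (segment ℝ x y) ⊆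
      ⋃ u ∈ Finset.range (N + 1),
        Metric.ball (AffineMap.lineMap x y ((u : ℝ) / N)) (2 * s) := by
    intro z hz
    obtain ⟨w, hw, hzw⟩ := Metric.mem_thickening_iff.1 hz
    rw [segment_eq_image_lineMap] at hw
    obtain ⟨t, ⟨ht0, ht1⟩, rfl⟩ := hw
    simp only [Set.mem_iUnion, Metric.mem_ball, Finset.mem_range]
    have hfl : ((⌊t * N⌋₊ : ℕ) : ℝ) ≤ t * N := Nat.floor_le (by positivity)
    have hfl' := Nat.lt_floor_add_one (t * N)
    refine ⟨⌊t * N⌋₊, ?_, ?_⟩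
    · have : ((⌊t * N⌋₊ : ℕ) : ℝ) ≤ N := hfl.trans (by nlinarith)
      exact Nat.lt_succ_of_le (by exact_mod_cast this)
    · have h1 : dist (AffineMap.lineMap x y t) (AffineMap.lineMap x y ((⌊t * N⌋₊ : ℝ) / N)) < s := by
        rw [dist_lineMap_lineMap, Real.dist_eq, abs_of_nonneg
          (by rw [sub_nonneg, div_le_iff₀ hN0]; exact hfl)]
        have : t - (⌊t * N⌋₊ : ℝ) / N ≤ 1 / N := by
          rw [sub_le_iff_le_add, ← add_div, le_div_iff₀ hN0]; linarith
        calc _ ≤ 1 / N * dist x y := by gcongr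
          _ < s := by rw [one_div, inv_mul_lt_iff₀ hN0]; linarith
      linarith [dist_triangle z (AffineMap.lineMap x y t)
        (AffineMap.lineMap x y ((⌊t * N⌋₊ : ℝ) / N))]
  have hfin : volume (⋃ u ∈ Finset.range (N + 1),
        Metric.ball (AffineMap.lineMap x y ((u : ℝ) / N) : Pt d) (2 * s)) ≠ ⊤ := by
    refine ((measure_biUnion_finset_le _ _).trans_lt ?_).ne
    exact ENNReal.sum_lt_top.2 fun _ _ => measure_ball_lt_top
  refine (measureReal_mono hsub hfin).trans ((measureReal_biUnion_finset_le _ _).trans ?_)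
  simp only [volume_real_ball _ (show 0 < 2 * s by positivity), Finset.sum_const,
    Finset.card_range, nsmul_eq_mul]
  have := unitBallVolume_pos d
  gcongr
  push_cast
  linarith

/-! ### Boxes: volume, diameter, intersection with balls. -/

theorem box_eq_preimage {d : ℕ} (a b : Fin d → ℝ) :
    box a b = (WithLp.ofLp : Pt d → Fin d → ℝ) ⁻¹' Set.univ.pi fun k => Set.Icc (a k) (b k) := by
  ext x; simp only [box, Set.mem_ofPred_eq, Set.mem_preimage, Set.mem_univ_pi]

theorem measurableSet_box {d : ℕ} (a b : Fin d → ℝ) : MeasurableSet (box a b) := by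
  rw [box_eq_preimage]
  exact (PiLp.volume_preserving_ofLp (Fin d)).measurable
    (MeasurableSet.univ_pi fun _ => measurableSet_Icc)

theorem volume_box {d : ℕ} (a b : Fin d → ℝ) :
    volume (box a b) = ∏ k, ENNReal.ofReal (b k - a k) := by
  rw [box_eq_preimage, (PiLp.volume_preserving_ofLp (Fin d)).measure_preimage
    (MeasurableSet.univ_pi fun _ => measurableSet_Icc).nullMeasurableSet, volume_pi_pi]
  simp

theorem volume_box_ne_top {d : ℕ} (a b : Fin d → ℝ) : volume (box a b) ≠ ⊤ := by
  rw [volume_box]; exact ENNReal.prod_ne_top fun _ _ => ENNReal.ofReal_ne_top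

theorem volume_real_box {d : ℕ} {a b : Fin d → ℝ} (h : ∀ k, a k ≤ b k) :
    volume.real (box a b) = ∏ k, (b k - a k) := by
  rw [measureReal_def, volume_box, ENNReal.toReal_prod]
  exact Finset.prod_congr rfl fun k _ => ENNReal.toReal_ofReal (sub_nonneg.2 (h k))

theorem dist_le_of_mem_box {d : ℕ} {a b : Fin d → ℝ} {M : ℝ} (hM : 0 ≤ M)
    (h : ∀ k, b k - a k ≤ M) {x y : Pt d} (hx : x ∈ box a b) (hy : y ∈ box a b) :
    dist x y ≤ d * M := by
  rw [EuclideanSpace.dist_eq]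
  refine Real.sqrt_le_iff.2 ⟨by positivity, ?_⟩
  have : ∀ k ∈ Finset.univ, dist (x k) (y k) ^ 2 ≤ M ^ 2 := by
    intro k _
    have hd : dist (x k) (y k) ≤ M := by
      rw [Real.dist_eq, abs_le]
      constructor <;> linarith [(hx k).1, (hx k).2, (hy k).1, (hy k).2, h k]
    gcongr
  refine (Finset.sum_le_sum this).trans ?_
  simp only [Finset.sum_const, Finset.card_univ, Fintype.card_fin, nsmul_eq_mul, mul_pow]
  have : (d : ℝ) ≤ (d : ℝ) ^ 2 := by
    exact_mod_cast Nat.le_self_pow two_ne_zero d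
  gcongr

/-- A ball centred in a box covers a fixed fraction of its volume inside the box, if its radius
does not exceed the side lengths. -/
theorem pow_le_volume_real_box_inter_ball {d : ℕ} (hd : 2 ≤ d) {a b : Fin d → ℝ} {r : ℝ}
    (hr : 0 < r) (h : ∀ k, r ≤ b k - a k) {x : Pt d} (hx : x ∈ box a b) :
    (r / d) ^ d ≤ volume.real (box a b ∩ Metric.ball x r) := by
  have hd0 : (0 : ℝ) < d := by positivity
  have hd2 : (2 : ℝ) ≤ d := by exact_mod_cast hd
  have ht : 0 < r / d := by positivity
  have ht2 : r / d * 2 ≤ r := by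
    rw [div_mul_eq_mul_div, div_le_iff₀ hd0]; gcongr
  -- Each side is at least `2 * (r / d)` long, so an interval of length `r / d` fits on one side of
  -- `x k`. The resulting cube lies within `r / √d < r` of `x`.
  have hex : ∀ k, ∃ u, a k ≤ u ∧ u + r / d ≤ b k ∧ x k - r / d ≤ u ∧ u ≤ x k := by
    intro k
    obtain ⟨h1, h2⟩ := hx k
    by_cases hk : x k + r / d ≤ b k
    · exact ⟨x k, h1, hk, by linarith, le_rfl⟩
    · exact ⟨x k - r / d, by linarith [h k], by linarith, le_rfl, by linarith⟩
  choose u h1 h2 h3 h4 using hex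
  have hsub : box u (fun k => u k + r / d) ⊆ box a b ∩ Metric.ball x r := by
    intro y hy
    refine ⟨fun k => ⟨(h1 k).trans (hy k).1, (hy k).2.trans (h2 k)⟩, ?_⟩
    rw [Metric.mem_ball, EuclideanSpace.dist_eq, Real.sqrt_lt' hr]
    have : ∀ k ∈ Finset.univ, dist (y k) (x k) ^ 2 ≤ (r / d) ^ 2 := by
      intro k _
      have hd : dist (y k) (x k) ≤ r / d := by
        rw [Real.dist_eq, abs_le]
        constructor <;> linarith [(hy k).1, (hy k).2, h3 k, h4 k]
      gcongr
    refine (Finset.sum_le_sum this).trans_lt ?_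
    simp only [Finset.sum_const, Finset.card_univ, Fintype.card_fin, nsmul_eq_mul]
    rw [div_pow, mul_div_assoc', div_lt_iff₀ (by positivity), mul_comm, pow_two (d : ℝ)]
    have : 0 < r ^ 2 := by positivity
    gcongr
    nlinarith
  have hle := measureReal_mono hsub (μ := volume)
    (ne_top_of_le_ne_top (volume_box_ne_top a b) (measure_mono Set.inter_subset_left))
  rw [volume_real_box fun k => by linarith] at hle
  simpa [div_pow] using hle

/-! ### The swath of the incremental tree. -/

/-- The point to which the point `p l` is attached (the point itself, for the first one). -/
noncomputable def attachPoint {d n : ℕ} (connect : Pt d → GeomGraph d → Pt d × Pt d)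
    (p : Fin n → Pt d) (l : Fin n) : Pt d :=
  if (l : ℕ) = 0 then p l else (connect (p l) (buildTree connect p l)).2

/-- This is what allows the points to be revealed in order: the tree that `p j` meets is fixed
before `p j` is drawn. -/
theorem buildTree_congr {d n : ℕ} (connect : Pt d → GeomGraph d → Pt d × Pt d)
    {p p' : Fin n → Pt d} (m : ℕ) (h : ∀ l : Fin n, (l : ℕ) < m → p l = p' l) :
    buildTree connect p m = buildTree connect p' m := by
  induction m with
  | zero => rfl
  | succ m ih =>
    simp only [buildTree]
    rw [ih fun l hl => h l (by omega)]
    split_ifs with hm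
    · rw [h ⟨m, hm⟩ (by simp)]
    · rfl

theorem mem_verts_buildTree {d n : ℕ} (connect : Pt d → GeomGraph d → Pt d × Pt d)
    (p : Fin n → Pt d) (m : ℕ) (l : Fin n) (hl : (l : ℕ) < m) :
    p l ∈ (buildTree connect p m).verts := by
  induction m with
  | zero => omega
  | succ m ih =>
    simp only [buildTree]
    split_ifs with hm
    · rcases Nat.lt_succ_iff_lt_or_eq.1 hl with h | h
      · exact Finset.mem_insert_of_mem (ih h)
      · have : l = ⟨m, hm⟩ := Fin.ext h
        rw [this]; exact Finset.mem_insert_self _ _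
    · exact ih (by omega)

theorem mem_swath_buildTree {d n : ℕ} (connect : Pt d → GeomGraph d → Pt d × Pt d)
    (p : Fin n → Pt d) (m : ℕ) (l : Fin n) (hl : (l : ℕ) < m) :
    p l ∈ (buildTree connect p m).swath :=
  Or.inl (mem_verts_buildTree connect p m l hl)

theorem swath_buildTree_subset {d n : ℕ} {connect : Pt d → GeomGraph d → Pt d × Pt d}
    (hc : IsTreeNN connect) (p : Fin n → Pt d) (j : Fin n) :
    (buildTree connect p j).swath ⊆
      ⋃ l ∈ Finset.Iio j, segment ℝ (p l) (attachPoint connect p l) := by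
  suffices ∀ m : ℕ, m ≤ j → (buildTree connect p m).swath ⊆
      ⋃ l ∈ Finset.Iio j, segment ℝ (p l) (attachPoint connect p l) from this j le_rfl
  intro m
  induction m with
  | zero => intro _ x hx; simp [buildTree, GeomGraph.swath] at hx
  | succ m ih =>
    intro hm x hx
    have hmn : m < n := by omega
    have hmj : (⟨m, hmn⟩ : Fin n) ∈ Finset.Iio j := by
      rw [Finset.mem_Iio, Fin.lt_def]; exact hm
    have ih := ih (by omega)
    have hold : x ∈ (buildTree connect p m).swath → x ∈
      ⋃ l ∈ Finset.Iio j, segment ℝ (p l) (attachPoint connect p l) := fun h => ih h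
    have hnew : x ∈ segment ℝ (p ⟨m, hmn⟩) (attachPoint connect p ⟨m, hmn⟩) → x ∈
      ⋃ l ∈ Finset.Iio j, segment ℝ (p l) (attachPoint connect p l) :=
      fun h => Set.mem_biUnion (Finset.mem_coe.2 hmj) h
    simp only [buildTree, hmn, dif_pos] at hx
    rcases hx with hx | hx
    · rcases Finset.mem_insert.1 (Finset.mem_coe.1 hx) with hx | hx
      · exact hnew (hx ▸ left_mem_segment ℝ _ _)
      · exact hold (Or.inl hx)
    · simp only [addPoint, Set.mem_iUnion] at hx
      obtain ⟨e, he, hxe⟩ := hx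
      have hold' : e ∈ (buildTree connect p m).edges → x ∈
          ⋃ l ∈ Finset.Iio j, segment ℝ (p l) (attachPoint connect p l) :=
        fun h => hold (Or.inr (Set.mem_biUnion h hxe))
      split_ifs at he with hne
      · rcases Finset.mem_insert.1 he with rfl | he
        · refine hnew ?_
          have hm0 : m ≠ 0 := by
            rintro rfl; simp [buildTree] at hne
          rw [(hc _ _ hne).1] at hxe
          simpa [attachPoint, hm0] using hxe
        · exact hold' he
      · exact hold' he

theorem dist_attachPoint_le {d n : ℕ} {connect : Pt d → GeomGraph d → Pt d × Pt d}
    (hc : IsTreeNN connect) (p : Fin n → Pt d) {l m : Fin n} (hml : m < l) :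
    dist (p l) (attachPoint connect p l) ≤ dist (p l) (p m) := by
  have hl : (l : ℕ) ≠ 0 := by rw [Fin.lt_def] at hml; omega
  rw [attachPoint, if_neg hl]
  exact (hc _ _ ⟨_, mem_verts_buildTree connect p l m hml⟩).2.2 _
    (mem_swath_buildTree connect p l m hml)

/-- The volume of a neighbourhood of the swath, of a radius that is a small multiple of
`δ = L / k ^ (1 / d)`. -/
theorem volume_real_thickening_swath_le {d n : ℕ} (hd : 2 ≤ d)
    {connect : Pt d → GeomGraph d → Pt d × Pt d} (hc : IsTreeNN connect) {p : Fin n → Pt d}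
    {j : Fin n} {D δ K C s : ℝ} (hδ : 0 < δ) (hC : 0 ≤ C) (hs : 0 < s)
    (hD : ∀ l < j, ∀ m < j, dist (p l) (p m) ≤ D) (hjK : (j : ℝ) ≤ K)
    (hDC : (3 * D) ^ d ≤ C * (K * δ ^ d)) :
    volume.real (Metric.thickening s (buildTree connect p j).swath) ≤
      ((1 + 4 * C) * (K * δ) / s + 2 * K) * ((2 * s) ^ d * unitBallVolume d) := by
  have hω := unitBallVolume_pos d
  have hsum : ∑ l ∈ Finset.Iio j, dist (p l) (attachPoint connect p l) ≤
      (1 + 4 * C) * (K * δ) := by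
    rcases Nat.eq_zero_or_pos (j : ℕ) with hj | hj
    · have : Finset.Iio j = ∅ := by
        ext l; simp only [Finset.mem_Iio, Fin.lt_def, Finset.notMem_empty, iff_false]; omega
      rw [this, Finset.sum_empty]
      have : 0 ≤ K := le_trans (Nat.cast_nonneg _) hjK
      positivity
    · have hn : 0 < n := by omega
      set z : Fin n := ⟨0, hn⟩ with hz
      have hzj : z < j := by rw [Fin.lt_def]; exact hj
      refine sum_length_le hd (Finset.Iio j) p _ (p z) (D := D) hδ hC
        (fun l hl => hD l (Finset.mem_Iio.1 hl) z hzj) ?_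
        (fun l _ m _ hml => dist_attachPoint_le hc p hml) (by simpa using hjK) hDC
      intro l hl
      by_cases h0 : (l : ℕ) = 0
      · rw [attachPoint, if_pos h0]
        exact hD l (Finset.mem_Iio.1 hl) l (Finset.mem_Iio.1 hl)
      · have hzl : z < l := by rw [Fin.lt_def]; exact Nat.pos_of_ne_zero h0
        exact (dist_attachPoint_le hc p hzl).trans (hD l (Finset.mem_Iio.1 hl) z hzj)
  have hsub : Metric.thickening s (buildTree connect p j).swath ⊆
      ⋃ l ∈ Finset.Iio j,
        Metric.thickening s (segment ℝ (p l) (attachPoint connect p l)) := by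
    refine (Metric.thickening_subset_of_subset s (swath_buildTree_subset hc p j)).trans ?_
    simp only [Metric.thickening_iUnion]
    exact subset_rfl
  have hfin : volume (⋃ l ∈ Finset.Iio j,
        Metric.thickening s (segment ℝ (p l) (attachPoint connect p l))) ≠ ⊤ := by
    refine ((measure_biUnion_finset_le _ _).trans_lt (ENNReal.sum_lt_top.2 fun l _ => ?_)).ne
    refine Bornology.IsBounded.measure_lt_top (Bornology.IsBounded.thickening ?_)
    rw [← convexHull_pair]
    exact isBounded_convexHull.2 (Set.toFinite _).isBounded
  refine (measureReal_mono hsub hfin).trans ((measureReal_biUnion_finset_le _ _).trans ?_)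
  refine (Finset.sum_le_sum fun l _ => volume_real_thickening_segment_le _ _ hs).trans ?_
  rw [← Finset.sum_mul, Finset.sum_add_distrib, ← Finset.sum_div]
  simp only [Finset.sum_const, Fin.card_Iio, nsmul_eq_mul]
  gcongr ?_ * _
  have : (∑ l ∈ Finset.Iio j, dist (p l) (attachPoint connect p l)) / s ≤
    (1 + 4 * C) * (K * δ) / s := by gcongr
  linarith

/-! ### The choice of scale. -/

theorem cond_box_real_apply {d : ℕ} (a b : Fin d → ℝ) (S : Set (Pt d)) :
    (cond (volume : Measure (Pt d)) (box a b)).real S =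
      volume.real (box a b ∩ S) / volume.real (box a b) := by
  rw [measureReal_def, cond_apply (measurableSet_box a b), ENNReal.toReal_mul,
    ENNReal.toReal_inv, div_eq_inv_mul]
  rfl

theorem exists_pow_mul_eq_one {d k : ℕ} (hd : d ≠ 0) (hk : 1 ≤ k) :
    ∃ h : ℝ, 0 < h ∧ h ≤ 1 ∧ (k : ℝ) * h ^ d = 1 := by
  have hk' : (1 : ℝ) ≤ k := by exact_mod_cast hk
  have hk0 : (0 : ℝ) < k := by linarith
  refine ⟨((k : ℝ)⁻¹) ^ ((d : ℝ)⁻¹), by positivity, ?_, ?_⟩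
  · exact Real.rpow_le_one (by positivity) (inv_le_one_of_one_le₀ hk') (by positivity)
  · rw [Real.rpow_inv_natCast_pow (by positivity) hd, mul_inv_cancel₀ hk0.ne']

/-- A distance `s` of the order of `k ^ (-1 / d)` such that the `s`-neighbourhood of any tree on
at most `k` points has probability at most `1 / 2`, while a ball of radius about `s` has
probability of the order of `1 / k`. -/
theorem exists_scale (d : ℕ) (hd : 2 ≤ d) (ρ : ℝ) (hρ : 1 ≤ ρ) :
    ∃ c₀ : ℝ, 0 < c₀ ∧ ∀ a b : Fin d → ℝ, (∀ k, a k < b k) →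
      (∀ k l, b k - a k ≤ ρ * (b l - a l)) → ∀ k : ℕ, 1 ≤ k → ∃ s : ℝ, 0 < s ∧
        (∀ connect : Pt d → GeomGraph d → Pt d × Pt d, IsTreeNN connect →
          ∀ (n : ℕ) (p : Fin n → Pt d) (j : Fin n), (j : ℕ) ≤ k → (∀ l < j, p l ∈ box a b) →
            (cond (volume : Measure (Pt d)) (box a b)).real
              (Metric.thickening s (buildTree connect p j).swath) ≤ 1 / 2) ∧
        (∀ x, (cond (volume : Measure (Pt d)) (box a b)).real (Metric.ball x s) ≤ 1 / (2 * k)) ∧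
        (∀ x ∈ box a b,
          c₀ / k ≤ (cond (volume : Measure (Pt d)) (box a b)).real (Metric.ball x (s / 2))) := by
  have hω := unitBallVolume_pos d
  set ω := unitBallVolume d with hωdef
  have hd0 : (0 : ℝ) < d := by positivity
  have hρ0 : 0 < ρ := by linarith
  -- The box has diameter at most `D = d * ρ * L`, and `(3 * D) ^ d = C * L ^ d`. `M` collects the
  -- constants of the swath volume, and `ε` is chosen so that `ε * M ≤ 1 / 2`.
  set C : ℝ := (3 * (d * ρ)) ^ d with hC
  have hC0 : 0 ≤ C := by positivity
  set M : ℝ := ω * 2 ^ d * (3 + 4 * C) with hM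
  have hMω : ω ≤ M := by
    rw [hM, mul_assoc]
    refine le_mul_of_one_le_right hω.le ?_
    have : (1 : ℝ) ≤ 2 ^ d := one_le_pow₀ one_le_two
    nlinarith
  have hM0 : 0 < M := hω.trans_le hMω
  set ε : ℝ := 1 / (2 * M + 1) with hε
  have hε0 : 0 < ε := by positivity
  have hε1 : ε ≤ 1 := by rw [hε, div_le_one (by positivity)]; linarith
  have hεM : ε * M ≤ 1 / 2 := by
    rw [hε, one_div_mul_eq_div, div_le_div_iff₀ (by positivity) two_pos]; linarith
  -- A cube of side `s / (2 * d)` fits in the box and in the ball of radius `s / 2`; the box has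
  -- volume at most `(ρ * L) ^ d`.
  refine ⟨(ε / (2 * d * ρ)) ^ d, by positivity, ?_⟩
  intro a b hab hratio k hk
  have : Nonempty (Fin d) := ⟨⟨0, by omega⟩⟩
  obtain ⟨k₀, hk₀⟩ := Finite.exists_min fun k => b k - a k
  set L : ℝ := b k₀ - a k₀ with hL
  have hL0 : 0 < L := sub_pos.2 (hab k₀)
  have hk1 : (1 : ℝ) ≤ k := by exact_mod_cast hk
  have hk0 : (0 : ℝ) < k := by linarith
  obtain ⟨h, h0, h1, hh⟩ := exists_pow_mul_eq_one (d := d) (by omega) hk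
  have hhd : h ^ d = 1 / k := by rw [eq_div_iff hk0.ne', mul_comm]; exact hh
  have hV := volume_real_box fun k => (hab k).le
  set V := volume.real (box a b) with hVdef
  have hVL : L ^ d ≤ V := by
    rw [hV]
    calc L ^ d = ∏ _k : Fin d, L := by simp
      _ ≤ _ := Finset.prod_le_prod (fun _ _ => hL0.le) fun k _ => hk₀ k
  have hVU : V ≤ (ρ * L) ^ d := by
    rw [hV]
    calc _ ≤ ∏ _k : Fin d, (ρ * L) :=
        Finset.prod_le_prod (fun k _ => (sub_pos.2 (hab k)).le) fun k _ => hratio k k₀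
      _ = _ := by simp
  have hLd : 0 < L ^ d := by positivity
  have hV0 : 0 < V := hLd.trans_le hVL
  have hfin : volume (box a b) ≠ ⊤ := volume_box_ne_top a b
  have hδ : 0 < L * h := by positivity
  have hs : 0 < ε * (L * h) := by positivity
  have hεd : ε ^ d ≤ ε ^ 2 := pow_le_pow_of_le_one hε0.le hε1 hd
  have hε2 : ε ^ 2 ≤ ε := by nlinarith
  refine ⟨ε * (L * h), hs, ?_, ?_, ?_⟩
  · intro connect hc n p j hj hp
    rw [cond_box_real_apply, div_le_iff₀ hV0]
    have hKδ : (k : ℝ) * (L * h) ^ d = L ^ d := by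
      rw [mul_pow, hhd]; field_simp
    have hvol := volume_real_thickening_swath_le hd hc (p := p) (j := j) (D := d * (ρ * L))
      (K := k) (C := C) hδ hC0 hs
      (fun l hl m hm => dist_le_of_mem_box (by positivity) (fun k => hratio k k₀) (hp l hl)
        (hp m hm)) (by exact_mod_cast hj)
      (by rw [hKδ, hC, ← mul_pow]; apply le_of_eq; ring)
    have hthick : volume (Metric.thickening (ε * (L * h)) (buildTree connect p j).swath) ≠ ⊤ := by
      refine (Bornology.IsBounded.measure_lt_top (Bornology.IsBounded.thickening ?_)).ne
      refine Bornology.IsBounded.union (Finset.finite_toSet _).isBounded ?_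
      refine (Bornology.isBounded_biUnion (Finset.finite_toSet _)).2 fun e _ => ?_
      rw [← convexHull_pair]
      exact isBounded_convexHull.2 (Set.toFinite _).isBounded
    refine (measureReal_mono Set.inter_subset_right hthick).trans (hvol.trans ?_)
    have : ((1 + 4 * C) * (k * (L * h)) / (ε * (L * h)) + 2 * k) *
        ((2 * (ε * (L * h))) ^ d * ω) =
        ω * 2 ^ d * ((1 + 4 * C) / ε + 2) * ε ^ d * L ^ d := by
      rw [mul_pow, mul_pow, mul_pow, hhd]; field_simp
    rw [this]
    calc ω * 2 ^ d * ((1 + 4 * C) / ε + 2) * ε ^ d * L ^ d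
        ≤ ω * 2 ^ d * ((1 + 4 * C) / ε + 2) * ε ^ 2 * L ^ d := by gcongr
      _ = ω * 2 ^ d * ((1 + 4 * C) * ε + 2 * ε ^ 2) * L ^ d := by field_simp
      _ ≤ ω * 2 ^ d * ((1 + 4 * C) * ε + 2 * ε) * L ^ d := by gcongr
      _ = ε * M * L ^ d := by rw [hM]; ring
      _ ≤ 1 / 2 * V := by gcongr
  · intro x
    rw [cond_box_real_apply, div_le_iff₀ hV0]
    refine (measureReal_mono Set.inter_subset_right measure_ball_lt_top.ne).trans ?_
    rw [volume_real_ball x hs]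
    calc (ε * (L * h)) ^ d * ω = (ε ^ d * ω) * (1 / k) * L ^ d := by
          rw [mul_pow, mul_pow, hhd]; ring
      _ ≤ (ε * M) * (1 / k) * L ^ d := by gcongr; exact hεd.trans hε2
      _ ≤ (1 / 2) * (1 / k) * V := by gcongr
      _ = _ := by ring
  · intro x hx
    rw [cond_box_real_apply, le_div_iff₀ hV0]
    have hle : ∀ k, ε * (L * h) / 2 ≤ b k - a k := by
      intro k
      have h2 : ε * (L * h) ≤ 1 * (L * 1) := by gcongr
      linarith [hk₀ k]
    refine le_trans ?_ (pow_le_volume_real_box_inter_ball hd (half_pos hs) hle hx)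
    calc (ε / (2 * d * ρ)) ^ d / k * V ≤ (ε / (2 * d * ρ)) ^ d / k * (ρ * L) ^ d := by gcongr
      _ = (ε / (2 * d * ρ) * (ρ * L) * h) ^ d := by
        rw [mul_pow _ h, hhd, mul_pow (ε / _)]; ring
      _ = _ := by congr 1; field_simp

/-! ### Revealing the points in stages. -/

/-- A lower bound for the (outer) product measure of a set by revealing the coordinates in the
order: those before `j`, the coordinate `j`, those after `j`. -/
theorem mul_le_measure_pi_of_stages {n : ℕ} {α : Type*} [MeasurableSpace α] (ν : Measure α)
    [IsProbabilityMeasure ν] (j : Fin n) (A : Set (Fin n → α)) (B : Set α) (hB : ν B = 1)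
    (G : (Fin n → α) → Set α) (S : α → Fin n → Set α) (c₁ c₂ : ENNReal)
    (hG : ∀ x y : Fin n → α, (∀ l < j, x l = y l) → G x = G y)
    (hc₁ : ∀ x : Fin n → α, (∀ l < j, x l ∈ B) → c₁ ≤ ν (G x))
    (hc₂ : ∀ x : Fin n → α, ∀ y ∈ G x, c₂ ≤ ∏ l ∈ Finset.Ioi j, ν (S y l))
    (hA : ∀ x : Fin n → α, x j ∈ G x → (∀ l, j < l → x l ∈ S (x j) l) → x ∈ A) :
    c₂ * c₁ ≤ Measure.pi (fun _ : Fin n => ν) A := by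
  classical
  set μ : Fin n → Measure α := fun _ => ν with hμ
  -- `A` need not be measurable, since the tie-breaking rule is arbitrary. A measurable hull of
  -- equal measure permits iterated integration.
  set H := toMeasurable (Measure.pi μ) A with hH
  set f : (Fin n → α) → ENNReal := H.indicator 1 with hf
  have hfm : Measurable f := measurable_one.indicator (measurableSet_toMeasurable _ _)
  have hlast : ∀ x : Fin n → α, x j ∈ G x → c₂ ≤ (∫⋯∫⁻_Finset.Ioi j, f ∂μ) x := by
    intro x hx
    refine (hc₂ x _ hx).trans ?_
    rw [← Finset.prod_coe_sort, ← Measure.pi_pi (fun l : Finset.Ioi j => μ l)]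
    refine meas_le_lintegral₀ (hfm.comp measurable_updateFinset).aemeasurable ?_
    intro y hy
    have hmem : Function.updateFinset x (Finset.Ioi j) y ∈ A := by
      have hlow : ∀ l, l ≤ j → Function.updateFinset x (Finset.Ioi j) y l = x l := by
        intro l hl
        simp [Function.updateFinset, not_lt.2 hl]
      refine hA _ ?_ ?_
      · rw [hlow j le_rfl, hG _ x fun l hl => hlow l hl.le]; exact hx
      · intro l hl
        rw [hlow j le_rfl]
        have := hy ⟨l, Finset.mem_Ioi.2 hl⟩ (Set.mem_univ _)
        simpa [Function.updateFinset, hl] using this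
    simp [hf, Set.indicator_of_mem (subset_toMeasurable (Measure.pi μ) A hmem), hH]
  -- Markov's inequality in the coordinate `j`; the points before `j` lie in `B` almost surely, so
  -- this case is enough.
  have hmid : ∀ x : Fin n → α, (∀ l < j, x l ∈ B) →
      c₂ * c₁ ≤ (∫⋯∫⁻_insert j (Finset.Ioi j), f ∂μ) x := by
    intro x hx
    rw [lmarginal_insert _ hfm (by simp)]
    have hm : Measurable fun y => (∫⋯∫⁻_Finset.Ioi j, f ∂μ) (Function.update x j y) :=
      (hfm.lmarginal μ).comp (measurable_update x)
    refine le_trans ?_ (mul_meas_ge_le_lintegral₀ hm.aemeasurable c₂)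
    gcongr
    refine (hc₁ x hx).trans (measure_mono fun y hy => hlast _ ?_)
    rw [Function.update_self, hG _ x fun l hl => Function.update_of_ne hl.ne _ _]
    exact hy
  have hne : Nonempty α := by
    by_contra h
    rw [not_nonempty_iff] at h
    have : B = ∅ := Set.eq_empty_of_isEmpty B
    simp [this] at hB
  obtain ⟨x₀⟩ : Nonempty (Fin n → α) := inferInstance
  have huniv : (Finset.univ : Finset (Fin n)) = Finset.Iio j ∪ insert j (Finset.Ioi j) := by
    ext l; simp only [Finset.mem_univ, Finset.mem_union, Finset.mem_Iio, Finset.mem_insert,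
      Finset.mem_Ioi, true_iff]
    rcases lt_trichotomy l j with h | h | h <;> simp [h]
  have hdisj : Disjoint (Finset.Iio j) (insert j (Finset.Ioi j)) := by
    rw [Finset.disjoint_left]
    intro l hl hl'
    simp only [Finset.mem_Iio, Finset.mem_insert, Finset.mem_Ioi] at hl hl'
    rcases hl' with h | h <;> omega
  calc c₂ * c₁ = c₂ * c₁ * Measure.pi (fun l : Finset.Iio j => μ l)
        (Set.univ.pi fun _ => B) := by
        rw [Measure.pi_pi]; simp [hμ, hB]
    _ ≤ (∫⋯∫⁻_Finset.Iio j, ∫⋯∫⁻_insert j (Finset.Ioi j), f ∂μ ∂μ) x₀ := by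
        refine le_trans ?_ (mul_meas_ge_le_lintegral₀
          ((hfm.lmarginal μ).comp measurable_updateFinset).aemeasurable (c₂ * c₁))
        gcongr
        intro y hy
        refine hmid _ fun l hl => ?_
        have := hy ⟨l, Finset.mem_Iio.2 hl⟩ (Set.mem_univ _)
        simpa [Function.updateFinset, hl] using this
    _ = Measure.pi μ A := by
        rw [← lmarginal_union μ f hfm hdisj, ← huniv, ← lintegral_eq_lmarginal_univ, hf,
          lintegral_indicator_one (measurableSet_toMeasurable _ _), measure_toMeasurable]

/-- Bernoulli's inequality: `(1 - 1 / (2 * k)) ^ k ≥ 1 / 2`. -/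
theorem half_le_prod {ι : Type*} (J : Finset ι) (g : ι → ℝ) (P : ι → Prop) [DecidablePred P]
    {k : ℕ} (hk : 1 ≤ k) (hJ : (J.filter P).card ≤ k)
    (hg : ∀ l ∈ J, P l → 1 - 1 / (2 * (k : ℝ)) ≤ g l) (hg' : ∀ l ∈ J, ¬ P l → 1 ≤ g l) :
    1 / 2 ≤ ∏ l ∈ J, g l := by
  have hk1 : (1 : ℝ) ≤ k := by exact_mod_cast hk
  have hq : 1 / (2 * (k : ℝ)) ≤ 1 / 2 := by
    rw [div_le_div_iff₀ (by positivity) two_pos]; linarith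
  have hq0 : 0 < 1 / (2 * (k : ℝ)) := by positivity
  calc (1 / 2 : ℝ) = 1 + k * (-(1 / (2 * (k : ℝ)))) := by field_simp; ring
    _ ≤ (1 + -(1 / (2 * (k : ℝ)))) ^ k := one_add_mul_le_pow (by linarith) k
    _ ≤ (1 + -(1 / (2 * (k : ℝ)))) ^ (J.filter P).card :=
        pow_le_pow_of_le_one (by linarith) (by linarith) hJ
    _ = ∏ l ∈ J, if P l then 1 + -(1 / (2 * (k : ℝ))) else 1 := by
        rw [Finset.prod_ite]; simp
    _ ≤ ∏ l ∈ J, g l := by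
        refine Finset.prod_le_prod (fun l _ => by split_ifs <;> linarith) fun l hl => ?_
        split_ifs with h
        · linarith [hg l hl h]
        · exact hg' l hl h

/-! ### The event for a fixed pair of indices. -/

theorem measurableSet_isNearestEarlier {d n : ℕ} (i j : Fin n) :
    MeasurableSet {p : Fin n → Pt d | IsNearestEarlier p i j} := by
  simp only [IsNearestEarlier, Set.ofPred_and, Set.ofPred_forall]
  refine (MeasurableSet.const _).inter (MeasurableSet.iInter fun k => MeasurableSet.iInter fun _ =>
    MeasurableSet.iInter fun _ => ?_)
  exact measurableSet_lt (by fun_prop) (by fun_prop)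

theorem IsNearestEarlier.unique {d n : ℕ} {p : Fin n → Pt d} {i j j' : Fin n}
    (h : IsNearestEarlier p i j) (h' : IsNearestEarlier p i j') : j = j' := by
  by_contra hne
  exact lt_asymm (h.2 j' h'.1 (Ne.symm hne)) (h'.2 j h.1 hne)

/-- The nearest earlier neighbour is `p j` and its edge is long, with probability of the order
of `1 / i`. -/
theorem le_measure_nearest_and_longer {d n : ℕ} (ν : Measure (Pt d)) [IsProbabilityMeasure ν]
    {connect : Pt d → GeomGraph d → Pt d × Pt d} (hc : IsTreeNN connect) {i j : Fin n}
    (hj : 0 < (j : ℕ)) (hji : j < i) {B : Set (Pt d)}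
    (hBm : MeasurableSet B) (hB : ν B = 1) {s c₀ : ℝ} (hc₀ : 0 ≤ c₀)
    (h1 : ∀ p : Fin n → Pt d, (∀ l < j, p l ∈ B) →
      ν.real (Metric.thickening s (buildTree connect p j).swath) ≤ 1 / 2)
    (h2 : ∀ x, ν.real (Metric.ball x s) ≤ 1 / (2 * (i : ℕ)))
    (h3 : ∀ x ∈ B, c₀ / (i : ℕ) ≤ ν.real (Metric.ball x (s / 2))) :
    ENNReal.ofReal (c₀ / (4 * (i : ℕ))) ≤ Measure.pi (fun _ : Fin n => ν)
      {p | OldEdgeIsLonger connect p i ∧ IsNearestEarlier p i j} := by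
  classical
  have hi : 1 ≤ (i : ℕ) := by rw [Fin.lt_def] at hji; omega
  set S : Pt d → Fin n → Set (Pt d) := fun y l =>
    if l < i then (Metric.ball y s)ᶜ else if l = i then Metric.ball y (s / 2) else Set.univ with hS
  have hprod : ENNReal.ofReal (c₀ / (4 * (i : ℕ))) =
      ENNReal.ofReal (c₀ / (i : ℕ) * (1 / 2)) * ENNReal.ofReal (1 / 2) := by
    rw [← ENNReal.ofReal_mul (by positivity)]; congr 1; ring
  rw [hprod]
  -- `p j` is also kept in `B`, because the lower bound `h3` for small balls holds only at centres
  -- in `B`.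
  refine mul_le_measure_pi_of_stages ν j _ B hB
    (fun x => B ∩ (Metric.thickening s (buildTree connect x j).swath)ᶜ) S _ _ ?_ ?_ ?_ ?_
  · intro x y hxy
    rw [buildTree_congr connect (j : ℕ) fun l hl => hxy l hl]
  · intro x hx
    have hm : MeasurableSet (Metric.thickening s (buildTree connect x j).swath) :=
      Metric.isOpen_thickening.measurableSet
    rw [Set.inter_comm, measure_inter_conull ((prob_compl_eq_zero_iff hBm).2 hB),
      ENNReal.ofReal_le_iff_le_toReal (measure_ne_top _ _)]
    have := probReal_compl_eq_one_sub (μ := ν) hm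
    rw [measureReal_def] at this
    rw [this]
    linarith [h1 x hx]
  · intro x y hy
    rw [← Finset.mul_prod_erase _ _ (Finset.mem_Ioi.2 hji)]
    have hhalf := half_le_prod ((Finset.Ioi j).erase i) (fun l => ν.real (S y l)) (· < i) hi
      ?_ ?_ ?_
    · have hreal : ∀ l, ν (S y l) = ENNReal.ofReal (ν.real (S y l)) :=
        fun l => (ofReal_measureReal (measure_ne_top _ _)).symm
      rw [hreal i, Finset.prod_congr rfl fun l _ => hreal l, ← ENNReal.ofReal_prod_of_nonneg
        fun _ _ => measureReal_nonneg, ← ENNReal.ofReal_mul measureReal_nonneg]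
      apply ENNReal.ofReal_le_ofReal
      have := h3 y hy.1
      gcongr
      simpa [hS] using this
    · calc _ ≤ (Finset.Iio i).card := Finset.card_le_card fun l hl => by
            simpa using (Finset.mem_filter.1 hl).2
        _ = i := by simp
    · intro l _ hl
      simp only [hS, hl, if_true]
      rw [probReal_compl_eq_one_sub measurableSet_ball]
      linarith [h2 y]
    · intro l hl' hl
      have : l ≠ i := Finset.ne_of_mem_erase hl'
      simp [hS, hl, this]
  · intro x hx hxS
    have hfar : ∀ q ∈ (buildTree connect x j).swath, s ≤ dist (x j) q := by
      intro q hq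
      by_contra hlt
      exact hx.2 (Metric.mem_thickening_iff.2 ⟨q, hq, not_le.1 hlt⟩)
    have hnear : dist (x i) (x j) < s / 2 := by simpa [hS] using hxS i hji
    have hs : 0 < s := by linarith [dist_nonneg (x := x i) (y := x j)]
    have hlfar : ∀ l, l < i → l ≠ j → s ≤ dist (x j) (x l) := by
      intro l hli hlj
      rcases lt_or_gt_of_ne hlj with h | h
      · exact hfar _ (mem_swath_buildTree connect x j l h)
      · have := hxS l h
        rw [dist_comm]
        simpa [hS, hli] using this
    -- Any other earlier point is at distance greater than `s - s / 2` from `x i`, while `x j` is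
    -- closer than `s / 2`.
    have hN : IsNearestEarlier x i j := by
      refine ⟨hji, fun l hli hlj => ?_⟩
      have := dist_triangle (x j) (x i) (x l)
      rw [dist_comm (x j) (x i)] at this
      linarith [hlfar l hli hlj]
    refine ⟨⟨j, hN, hj, ?_⟩, hN⟩
    have hne : (buildTree connect x j).verts.Nonempty :=
      ⟨_, mem_verts_buildTree connect x j ⟨0, by omega⟩ hj⟩
    obtain ⟨he1, he2, -⟩ := hc (x j) _ hne
    rw [edgeLength, he1]
    linarith [hfar _ he2]

/-! ### Averaging over the index. -/

theorem lintegral_uniformOn_univ {n : ℕ} (f : Fin n → ENNReal) :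
    ∫⁻ i, f i ∂(uniformOn (Set.univ : Set (Fin n))) = (n : ENNReal)⁻¹ * ∑ i, f i := by
  rw [uniformOn, ProbabilityTheory.cond, lintegral_smul_measure, Measure.restrict_univ, lintegral_count,
    tsum_fintype]
  simp [Measure.count_apply]

theorem mainTheorem3 (d : ℕ) (hd : 2 ≤ d) (ρ : ℝ) :
    ∃ c : ℝ, 0 < c ∧
      ∀ a b : Fin d → ℝ, (∀ k, a k < b k) → (∀ k l, b k - a k ≤ ρ * (b l - a l)) →
        ∀ connect : Pt d → GeomGraph d → Pt d × Pt d, IsTreeNN connect →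
          ∀ n : ℕ, 3 ≤ n →
            ENNReal.ofReal c ≤
              sampleLaw n a b {ω | OldEdgeIsLonger connect ω.1 ω.2} := by
  -- For `ρ < 1` the ratio condition with equal indices excludes every box.
  by_cases hρ : 1 ≤ ρ
  swap
  · refine ⟨1, one_pos, fun a b hab hratio => absurd ?_ hρ⟩
    have k : Fin d := ⟨0, by omega⟩
    have := hratio k k
    exact le_of_mul_le_mul_right (by linarith) (sub_pos.2 (hab k))
  obtain ⟨c₀, hc₀, hscale⟩ := exists_scale d hd ρ hρ
  -- `(i - 1) * c₀ / (4 * i) ≥ c₀ / 8` for `i ≥ 2`, and `(n - 2) / n ≥ 1 / 3` for `n ≥ 3`. Indices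
  -- start at `0`, so `i ≥ 2` leaves some `j` with `1 ≤ j < i`.
  refine ⟨c₀ / 24, by positivity, ?_⟩
  intro a b hab hratio connect hc n hn
  set ν := cond (volume : Measure (Pt d)) (box a b) with hν
  have hpos : volume (box a b) ≠ 0 := by
    rw [volume_box]
    refine Finset.prod_ne_zero_iff.2 fun k _ => ?_
    simpa using hab k
  have : IsProbabilityMeasure ν :=
    cond_isProbabilityMeasure_of_finite hpos (volume_box_ne_top a b)
  have hB : ν (box a b) = 1 := cond_apply_self hpos (volume_box_ne_top a b)
  have : Nonempty (Fin n) := ⟨⟨0, by omega⟩⟩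
  set π := Measure.pi fun _ : Fin n => ν with hπ
  have hslice : ∀ i : Fin n, 2 ≤ (i : ℕ) →
      ENNReal.ofReal (c₀ / 8) ≤ π {p | OldEdgeIsLonger connect p i} := by
    intro i hi
    have hi0 : (2 : ℝ) ≤ (i : ℕ) := by exact_mod_cast hi
    obtain ⟨s, -, h1, h2, h3⟩ := hscale a b hab hratio i (by omega)
    set O : Set (Fin n → Pt d) := {p | OldEdgeIsLonger connect p i} with hO
    -- Only the nearest-neighbour events are known to be measurable; intersecting them with a hull
    -- of `O` makes additivity over `j` available.
    set H := toMeasurable π O with hH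
    set j₁ : Fin n := ⟨1, by omega⟩ with hj₁
    calc ENNReal.ofReal (c₀ / 8)
        ≤ ENNReal.ofReal (((i - 1 : ℕ) : ℝ) * (c₀ / (4 * (i : ℕ)))) := by
          apply ENNReal.ofReal_le_ofReal
          rw [Nat.cast_sub (by omega), mul_div_assoc', div_le_div_iff₀ (by norm_num)
            (by positivity)]
          push_cast
          nlinarith
      _ = ∑ j ∈ Finset.Ico j₁ i, ENNReal.ofReal (c₀ / (4 * (i : ℕ))) := by
          rw [ENNReal.ofReal_mul (by positivity), ENNReal.ofReal_natCast]
          simp [hj₁]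
      _ ≤ ∑ j ∈ Finset.Ico j₁ i, π (H ∩ {p | IsNearestEarlier p i j}) := by
          gcongr with j hj
          obtain ⟨hj1, hji⟩ := Finset.mem_Ico.1 hj
          refine (le_measure_nearest_and_longer ν hc (by rw [Fin.le_def] at hj1; exact hj1) hji
            (measurableSet_box a b) hB hc₀.le
            (fun p hp => h1 connect hc n p j (Fin.lt_def.1 hji).le hp) h2 h3).trans
            (measure_mono fun p hp => ?_)
          exact ⟨subset_toMeasurable π O hp.1, hp.2⟩
      _ = π (⋃ j ∈ Finset.Ico j₁ i, H ∩ {p | IsNearestEarlier p i j}) := by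
          refine (measure_biUnion_finset ?_ fun j _ =>
            (measurableSet_toMeasurable _ _).inter (measurableSet_isNearestEarlier i j)).symm
          intro j _ j' _ hjj
          exact Set.disjoint_left.2 fun p hp hp' => hjj (hp.2.unique hp'.2)
      _ ≤ π H := measure_mono (Set.iUnion₂_subset fun _ _ => Set.inter_subset_left)
      _ = π O := measure_toMeasurable _
  rw [sampleLaw]
  set P := π.prod (uniformOn (Set.univ : Set (Fin n))) with hP
  set E : Set ((Fin n → Pt d) × Fin n) := {ω | OldEdgeIsLonger connect ω.1 ω.2} with hE
  rw [← measure_toMeasurable, Measure.prod_apply_symm (measurableSet_toMeasurable _ _),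
    lintegral_uniformOn_univ]
  have hn' : (3 : ℝ) ≤ n := by exact_mod_cast hn
  have hn0 : (0 : ℝ) < n := by linarith
  calc ENNReal.ofReal (c₀ / 24)
      ≤ ENNReal.ofReal ((n : ℝ)⁻¹ * (((n - 2 : ℕ) : ℝ) * (c₀ / 8))) := by
        apply ENNReal.ofReal_le_ofReal
        rw [Nat.cast_sub (by omega), ← div_eq_inv_mul, le_div_iff₀ hn0]
        push_cast
        nlinarith
    _ = (n : ENNReal)⁻¹ * ∑ i ∈ Finset.Ici (⟨2, by omega⟩ : Fin n), ENNReal.ofReal (c₀ / 8) := by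
        rw [ENNReal.ofReal_mul (by positivity), ENNReal.ofReal_inv_of_pos hn0,
          ENNReal.ofReal_natCast, ENNReal.ofReal_mul (by positivity), ENNReal.ofReal_natCast]
        simp
    _ ≤ (n : ENNReal)⁻¹ * ∑ i ∈ Finset.Ici (⟨2, by omega⟩ : Fin n),
          π ((fun p => (p, i)) ⁻¹' toMeasurable P E) := by
        gcongr with i hi
        refine (hslice i (Fin.le_def.1 (Finset.mem_Ici.1 hi))).trans (measure_mono fun p hp => ?_)
        exact subset_toMeasurable P E hp
    _ ≤ _ := by
        gcongr
        exact Finset.subset_univ _
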